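/- Let $d\in\mathbb N$, $p\in[1,\infty)$, and let $\mathcal P_p(\mathbb R^d)$ be the set of Borel probability measures $\mu$ on $\mathbb R^d$ (with the Euclidean norm $|\cdot|$) such that $\int|x|^p\,d\mu(x)<\infty$. For $\mu,\nu\in\mathcal P_p(\mathbb R^d)$ let $W_p^p(\mu,\nu)=\min_{\gamma\in\Pi(\mu,\nu)}\int|x-y|^p\,d\gamma(x,y)$, where $\Pi(\mu,\nu)$ is the set of couplings of $\mu$ and $\nu$. Let $\mathcal H^1$ be the one-dimensional Hausdorff measure. For $\nu\in\mathcal P_p(\mathbb R^d)$ put $\mathcal L(\nu)=\min\{\alpha\ge 0:\ \alpha\nu\ge\mathcal H^1\llcorner\operatorname{supp}\nu\}$ if $\operatorname{supp}\nu$ is connected (with $\min\emptyset=+\infty$), and $\mathcal L(\nu)=+\infty$ otherwise. Given $\rho_0\in\mathcal P_p(\mathbb R^d)$ and $\Lambda\ge 0$, consider the problem $$(\bar P_\Lambda)\qquad \inf_{\nu\in\mathcal P_p(\mathbb R^d)} W_p^p(\rho_0,\nu)+\Lambda\,\mathcal L(\nu)$$ (with $0\cdot\infty=0$ when $\Lambda=0$).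 A $p$-mean of $\rho_0$ is a point $y\in\mathbb R^d$ that minimizes $y\mapsto\int|x-y|^p\,d\rho_0(x)$ over $\mathbb R^d$. **Theorem 4.1.** For every $\rho_0\in\mathcal P_p(\mathbb R^d)$ there exists $\Lambda_\star\in[0,\infty)$ such that 1. for every $0\le\Lambda<\Lambda_\star$, no minimizer of $(\bar P_\Lambda)$ is a Dirac mass; 2. for every $\Lambda>\Lambda_\star$, the set of minimizers of $(\bar P_\Lambda)$ is exactly $\{\delta_y : y \text{ is a } p\text{-mean of } \rho_0\}$; 3. $\Lambda_\star=0$ if and only if $\rho_0$ is a Dirac mass. -/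

import Mathlib

open MeasureTheory
open scoped NNReal ENNReal

noncomputable section

namespace WassersteinLength

/-- Probability measures on `ℝ^d` (Euclidean norm) with finite moment of order `p`. -/
def ProbP (d : ℕ) (p : ℝ) : Set (Measure (EuclideanSpace ℝ (Fin d))) :=
  {μ | IsProbabilityMeasure μ ∧ ∫⁻ x, ‖x‖ₑ ^ p ∂μ < ∞}

variable {d : ℕ}

/-- Transport couplings between `μ` and `ν`: measures on the product with marginals `μ`, `ν`
(automatically probability measures when `μ` is one). -/
def couplings (μ ν : Measure (EuclideanSpace ℝ (Fin d))) :
    Set (Measure (EuclideanSpace ℝ (Fin d) × EuclideanSpace ℝ (Fin d))) :=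
  {γ | γ.map Prod.fst = μ ∧ γ.map Prod.snd = ν}

/-- `W_p^p(μ, ν)`, the optimal transport cost for `|x - y|^p`. -/
def wassersteinPow (p : ℝ) (μ ν : Measure (EuclideanSpace ℝ (Fin d))) : ℝ≥0∞ :=
  ⨅ γ ∈ couplings μ ν, ∫⁻ z, ‖z.1 - z.2‖ₑ ^ p ∂γ

open Classical in
/-- The length functional: the least `α ≥ 0` with `α ν ≥ ℋ¹ ⌞ supp ν` if `supp ν` is connected
(`+∞` if there is no such `α`), and `+∞` if `supp ν` is not connected. -/
def lengthFunctional (ν : Measure (EuclideanSpace ℝ (Fin d))) : ℝ≥0∞ :=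
  if IsConnected ν.support then
    ⨅ (α : ℝ≥0) (_ : (Measure.hausdorffMeasure 1).restrict ν.support ≤ α • ν), (α : ℝ≥0∞)
  else ∞

/-- The relaxed energy `W_p^p(ρ₀, ν) + Λ ℒ(ν)`; in `ℝ≥0∞`, `0 * ∞ = 0`. -/
def energy (p : ℝ) (ρ₀ : Measure (EuclideanSpace ℝ (Fin d))) (Λ : ℝ≥0)
    (ν : Measure (EuclideanSpace ℝ (Fin d))) : ℝ≥0∞ :=
  wassersteinPow p ρ₀ ν + (Λ : ℝ≥0∞) * lengthFunctional ν

/-- The set of minimizers of the relaxed energy over probability measures with finite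
moment of order `p`. -/
def minimizers (p : ℝ) (ρ₀ : Measure (EuclideanSpace ℝ (Fin d))) (Λ : ℝ≥0) :
    Set (Measure (EuclideanSpace ℝ (Fin d))) :=
  {ν | ν ∈ ProbP d p ∧ ∀ μ ∈ ProbP d p, energy p ρ₀ Λ ν ≤ energy p ρ₀ Λ μ}

/-- The `p`-means of `ρ₀`: minimizers of `y ↦ ∫ |x - y|^p dρ₀(x)`. -/
def pMeans (p : ℝ) (ρ₀ : Measure (EuclideanSpace ℝ (Fin d))) :
    Set (EuclideanSpace ℝ (Fin d)) :=
  {y | ∀ z, ∫⁻ x, ‖x - y‖ₑ ^ p ∂ρ₀ ≤ ∫⁻ x, ‖x - z‖ₑ ^ p ∂ρ₀}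

/-- Being a Dirac mass. -/
def IsDirac (ν : Measure (EuclideanSpace ℝ (Fin d))) : Prop :=
  ∃ x, ν = Measure.dirac x

end WassersteinLength

end

open Filter Topology
open scoped MeasureTheory

namespace WassersteinLength

/-! Fix a `p`-mean `y` of cost `m`. A Dirac mass has length zero, so its energy does not depend on
`Λ`, and the best Dirac energy is `m`. The threshold is the infimum of `diracOptimal`, the set of
`Λ` at which no competitor has energy below `m`. A Dirac minimizer puts `Λ` in this set, so there is
none below the infimum. Above it, compare with some smaller `Λ'` in the set: a minimizer `ν` must
have `(Λ - Λ') ℒ(ν) = 0`, and zero length forces a Dirac mass (`minimizers_eq_of_lt`).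

The set is nonempty because a support of finite length has diameter at most that length: collapsing
`ν` to a point raises the `L^p` cost by at most `ℒ(ν)`, and convexity of `t ^ p` makes this linear
in `ℒ(ν)` (`le_wassersteinPow_add_lengthFunctional`). The threshold is positive for a non-Dirac
measure because splitting the mass between two points strictly lowers the transport cost, and a
little mass spread along the joining segment makes the length finite (`exists_wassersteinPow_lt`).
-/

/-- A connected set has diameter at most its one-dimensional Hausdorff measure. -/
lemma edist_le_hausdorffMeasure_one {X : Type*} [MetricSpace X] [MeasurableSpace X]
    [BorelSpace X] {s : Set X} (hs : IsPreconnected s) {x y : X} (hx : x ∈ s) (hy : y ∈ s) :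
    edist x y ≤ μH[1] s := by
  have hL : LipschitzWith 1 (fun z => dist x z) := LipschitzWith.dist_right x
  have hconn := hs.image _ hL.continuous.continuousOn
  -- The 1-Lipschitz map `dist x` sends the connected set onto an interval-containing set, reducing
  -- the bound to Lebesgue measure on the line.
  have hsub : Set.Icc 0 (dist x y) ⊆ (fun z => dist x z) '' s :=
    hconn.Icc_subset ⟨x, hx, dist_self x⟩ ⟨y, hy, rfl⟩
  have hle := hL.hausdorffMeasure_image_le zero_le_one s
  calc edist x y = volume (Set.Icc 0 (dist x y)) := by
        rw [Real.volume_Icc, sub_zero, edist_dist]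
    _ = μH[1] (Set.Icc 0 (dist x y)) := by rw [hausdorffMeasure_real]
    _ ≤ μH[1] ((fun z => dist x z) '' s) := measure_mono hsub
    _ ≤ μH[1] s := by simpa using hle

lemma eq_dirac_of_support_subset {X : Type*} [TopologicalSpace X] [HereditarilyLindelofSpace X]
    [MeasurableSpace X] {μ : Measure X} [IsProbabilityMeasure μ] {y : X}
    (h : μ.support ⊆ {y}) : μ = Measure.dirac y := by
  have hae : ∀ᵐ x ∂μ, x = y := by
    filter_upwards [Measure.support_mem_ae (μ := μ)] with x hx using h hx
  calc μ = μ.map id := Measure.map_id.symm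
    _ = μ.map (fun _ => y) := Measure.map_congr hae
    _ = Measure.dirac y := by simp

/-! ### Length functional and Dirac masses -/

variable {d : ℕ} {p : ℝ}

lemma hausdorffMeasure_support_le_lengthFunctional (ν : Measure (EuclideanSpace ℝ (Fin d)))
    [IsProbabilityMeasure ν] : μH[1] ν.support ≤ lengthFunctional ν := by
  unfold lengthFunctional
  split_ifs
  · refine le_iInf₂ fun α hα => ?_
    calc μH[1] ν.support = (μH[1]).restrict ν.support ν.support := by
          rw [Measure.restrict_apply_self]
      _ ≤ (α • ν) ν.support := hα _
      _ = α * ν ν.support := rfl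
      _ ≤ α * 1 := by gcongr; exact prob_le_one
      _ = α := mul_one _
  · exact le_top

lemma isConnected_support_of_lengthFunctional_ne_top {ν : Measure (EuclideanSpace ℝ (Fin d))}
    (h : lengthFunctional ν ≠ ∞) : IsConnected ν.support := by
  by_contra hc
  exact h (if_neg hc)

lemma edist_le_lengthFunctional {ν : Measure (EuclideanSpace ℝ (Fin d))}
    [IsProbabilityMeasure ν] (h : lengthFunctional ν ≠ ∞) {x y : EuclideanSpace ℝ (Fin d)}
    (hx : x ∈ ν.support) (hy : y ∈ ν.support) : edist x y ≤ lengthFunctional ν :=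
  (edist_le_hausdorffMeasure_one
    (isConnected_support_of_lengthFunctional_ne_top h).isPreconnected hx hy).trans
    (hausdorffMeasure_support_le_lengthFunctional ν)

lemma isDirac_of_lengthFunctional_eq_zero {ν : Measure (EuclideanSpace ℝ (Fin d))}
    [IsProbabilityMeasure ν] (h : lengthFunctional ν = 0) : IsDirac ν := by
  have hfin : lengthFunctional ν ≠ ∞ := by simp [h]
  obtain ⟨y, hy⟩ := (isConnected_support_of_lengthFunctional_ne_top hfin).nonempty
  refine ⟨y, eq_dirac_of_support_subset fun x hx => ?_⟩
  have := edist_le_lengthFunctional hfin hx hy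
  rw [h] at this
  simpa using this

lemma lengthFunctional_dirac (y : EuclideanSpace ℝ (Fin d)) :
    lengthFunctional (Measure.dirac y) = 0 := by
  have hsub : (Measure.dirac y).support ⊆ {y} :=
    Measure.support_subset_of_isClosed isClosed_singleton (by simp)
  have hne : (Measure.dirac y).support.Nonempty :=
    Measure.nonempty_support (NeZero.ne _)
  have hs : (Measure.dirac y).support = {y} := (hne.subset_singleton_iff).1 hsub
  unfold lengthFunctional
  rw [if_pos (by rw [hs]; exact isConnected_singleton)]
  refine le_antisymm (iInf₂_le_of_le 0 ?_ (by simp)) zero_le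
  have := Measure.nullSingletonClass_hausdorff (EuclideanSpace ℝ (Fin d)) (d := 1) one_pos
  rw [hs, Measure.restrict_singleton]
  simp

lemma dirac_mem_ProbP (hp : 1 ≤ p) (y : EuclideanSpace ℝ (Fin d)) :
    Measure.dirac y ∈ ProbP d p := by
  refine ⟨inferInstance, ?_⟩
  rw [lintegral_dirac]
  exact ENNReal.rpow_lt_top_of_nonneg (by linarith) (by simp)

/-! ### Couplings and transport cost -/

lemma lintegral_fst_of_mem_couplings {μ ν : Measure (EuclideanSpace ℝ (Fin d))}
    {γ : Measure (EuclideanSpace ℝ (Fin d) × EuclideanSpace ℝ (Fin d))}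
    (hγ : γ ∈ couplings μ ν) {f : EuclideanSpace ℝ (Fin d) → ℝ≥0∞} (hf : Measurable f) :
    ∫⁻ z, f z.1 ∂γ = ∫⁻ x, f x ∂μ := by
  rw [← hγ.1, lintegral_map hf measurable_fst]

lemma lintegral_snd_of_mem_couplings {μ ν : Measure (EuclideanSpace ℝ (Fin d))}
    {γ : Measure (EuclideanSpace ℝ (Fin d) × EuclideanSpace ℝ (Fin d))}
    (hγ : γ ∈ couplings μ ν) {f : EuclideanSpace ℝ (Fin d) → ℝ≥0∞} (hf : Measurable f) :
    ∫⁻ z, f z.2 ∂γ = ∫⁻ x, f x ∂ν := by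
  rw [← hγ.2, lintegral_map hf measurable_snd]

lemma ae_snd_of_mem_couplings {μ ν : Measure (EuclideanSpace ℝ (Fin d))}
    {γ : Measure (EuclideanSpace ℝ (Fin d) × EuclideanSpace ℝ (Fin d))}
    (hγ : γ ∈ couplings μ ν) {q : EuclideanSpace ℝ (Fin d) → Prop} (hq : ∀ᵐ x ∂ν, q x) :
    ∀ᵐ z ∂γ, q z.2 := by
  rw [← hγ.2] at hq
  exact ae_of_ae_map measurable_snd.aemeasurable hq

lemma lintegral_cost_lt_top (hp : 1 ≤ p) {μ ν : Measure (EuclideanSpace ℝ (Fin d))}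
    (hμ : μ ∈ ProbP d p) (hν : ν ∈ ProbP d p)
    {γ : Measure (EuclideanSpace ℝ (Fin d) × EuclideanSpace ℝ (Fin d))}
    (hγ : γ ∈ couplings μ ν) : ∫⁻ z, ‖z.1 - z.2‖ₑ ^ p ∂γ < ∞ := by
  have hm : Measurable fun x : EuclideanSpace ℝ (Fin d) => ‖x‖ₑ ^ p := by fun_prop
  calc ∫⁻ z, ‖z.1 - z.2‖ₑ ^ p ∂γ
      ≤ ∫⁻ z, 2 ^ (p - 1) * (‖z.1‖ₑ ^ p + ‖z.2‖ₑ ^ p) ∂γ := by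
        refine lintegral_mono fun z => ?_
        calc ‖z.1 - z.2‖ₑ ^ p ≤ (‖z.1‖ₑ + ‖z.2‖ₑ) ^ p :=
              ENNReal.rpow_le_rpow enorm_sub_le (by linarith)
          _ ≤ _ := ENNReal.rpow_add_le_mul_rpow_add_rpow _ _ hp
    _ = 2 ^ (p - 1) * (∫⁻ x, ‖x‖ₑ ^ p ∂μ + ∫⁻ x, ‖x‖ₑ ^ p ∂ν) := by
        rw [lintegral_const_mul _ (by fun_prop), lintegral_add_left (by fun_prop),
          lintegral_fst_of_mem_couplings hγ hm, lintegral_snd_of_mem_couplings hγ hm]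
    _ < ∞ := ENNReal.mul_lt_top
        (ENNReal.rpow_lt_top_of_nonneg (by linarith) (by simp))
        (ENNReal.add_lt_top.2 ⟨hμ.2, hν.2⟩)

lemma map_prodMk_mem_couplings {μ : Measure (EuclideanSpace ℝ (Fin d))}
    {T : EuclideanSpace ℝ (Fin d) → EuclideanSpace ℝ (Fin d)} (hT : Measurable T) :
    μ.map (fun x => (x, T x)) ∈ couplings μ (μ.map T) := by
  constructor
  · rw [Measure.map_map measurable_fst (by fun_prop)]
    exact Measure.map_id
  · rw [Measure.map_map measurable_snd (by fun_prop)]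
    rfl

lemma lintegral_cost_map_prodMk {μ : Measure (EuclideanSpace ℝ (Fin d))}
    {T : EuclideanSpace ℝ (Fin d) → EuclideanSpace ℝ (Fin d)} (hT : Measurable T) :
    ∫⁻ z, ‖z.1 - z.2‖ₑ ^ p ∂(μ.map fun x => (x, T x)) = ∫⁻ x, ‖x - T x‖ₑ ^ p ∂μ := by
  rw [lintegral_map (by fun_prop) (by fun_prop)]

lemma wassersteinPow_dirac (μ : Measure (EuclideanSpace ℝ (Fin d))) [IsProbabilityMeasure μ]
    (y : EuclideanSpace ℝ (Fin d)) :
    wassersteinPow p μ (Measure.dirac y) = ∫⁻ x, ‖x - y‖ₑ ^ p ∂μ := by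
  refine le_antisymm ?_ (le_iInf₂ fun γ hγ => ?_)
  · have h := map_prodMk_mem_couplings (μ := μ) (T := fun _ => y) measurable_const
    rw [Measure.map_const, measure_univ, one_smul] at h
    exact (iInf₂_le _ h).trans_eq (lintegral_cost_map_prodMk measurable_const)
  · rw [← lintegral_fst_of_mem_couplings hγ (f := fun x => ‖x - y‖ₑ ^ p) (by fun_prop)]
    refine (lintegral_congr_ae ?_).le
    have hy : ∀ᵐ x ∂(Measure.dirac y), x = y := by simp [ae_dirac_eq]
    filter_upwards [ae_snd_of_mem_couplings hγ hy] with z hz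
    rw [hz]

lemma energy_dirac (μ : Measure (EuclideanSpace ℝ (Fin d))) [IsProbabilityMeasure μ] (Λ : ℝ≥0)
    (y : EuclideanSpace ℝ (Fin d)) :
    energy p μ Λ (Measure.dirac y) = ∫⁻ x, ‖x - y‖ₑ ^ p ∂μ := by
  rw [energy, lengthFunctional_dirac, mul_zero, add_zero, wassersteinPow_dirac]

lemma lintegral_sub_rpow_lt_top (hp : 1 ≤ p) {μ : Measure (EuclideanSpace ℝ (Fin d))}
    (hμ : μ ∈ ProbP d p) (y : EuclideanSpace ℝ (Fin d)) : ∫⁻ x, ‖x - y‖ₑ ^ p ∂μ < ∞ := by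
  have := hμ.1
  have h := map_prodMk_mem_couplings (μ := μ) (T := fun _ => y) measurable_const
  rw [Measure.map_const, measure_univ, one_smul] at h
  rw [← lintegral_cost_map_prodMk (μ := μ) (T := fun _ => y) measurable_const]
  exact lintegral_cost_lt_top hp hμ (dirac_mem_ProbP hp y) h

/-! ### Lower bound for the energy -/

/-- The tangent-line inequality for `t ↦ t ^ p` at `b`, in the form of an upper bound on `b ^ p`. -/
lemma rpow_le_rpow_add_mul_of_le_add (hp : 1 ≤ p) {a b l : ℝ} (ha : 0 ≤ a) (hb : 0 ≤ b)
    (hl : 0 ≤ l) (h : b ≤ a + l) : b ^ p ≤ a ^ p + p * b ^ (p - 1) * l := by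
  have hp0 : 0 < p := by linarith
  rcases hb.eq_or_lt with rfl | hb
  · rw [Real.zero_rpow hp0.ne']
    positivity
  have hbern := one_add_mul_self_le_rpow_one_add (s := a / b - 1)
    (by have := div_nonneg ha hb.le; linarith) hp
  have hbp : 0 < b ^ p := Real.rpow_pos_of_pos hb p
  rw [show 1 + (a / b - 1) = a / b by ring, Real.div_rpow ha hb.le, le_div_iff₀ hbp] at hbern
  have hb1 : b ^ p = b ^ (p - 1) * b := by
    rw [Real.rpow_sub_one hb.ne', div_mul_cancel₀ _ hb.ne']
  have hexp : (1 + p * (a / b - 1)) * b ^ p = b ^ p - p * b ^ (p - 1) * (b - a) := by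
    rw [hb1]; field_simp; ring
  have hmul : p * b ^ (p - 1) * (b - a) ≤ p * b ^ (p - 1) * l := by
    gcongr; linarith
  linarith

/-- The tangent-line inequality at `b = m ^ (1 / p)`, whose slope is `p * m ^ (1 - 1 / p)`. -/
lemma ennreal_le_add_mul_of_rpow_inv_le_add (hp : 1 ≤ p) {m c l : ℝ≥0∞} (hm : m ≠ ∞)
    (h : m ^ (1 / p) ≤ c ^ (1 / p) + l) :
    m ≤ c + ENNReal.ofReal (p * m.toReal ^ (1 - 1 / p)) * l := by
  have hp0 : 0 < p := by linarith
  -- Removing `m = 0` makes the slope positive, so that its product with `l = ∞` is `∞`.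
  rcases eq_or_ne m 0 with rfl | hm0
  · exact zero_le
  rcases eq_or_ne c ∞ with rfl | hc
  · simp
  have hmpos : 0 < m.toReal := ENNReal.toReal_pos hm0 hm
  have hcoef : 0 < p * m.toReal ^ (1 - 1 / p) := by positivity
  rcases eq_or_ne l ∞ with rfl | hl
  · rw [ENNReal.mul_top (by simpa using hcoef)]; simp
  lift m to ℝ≥0 using hm
  lift c to ℝ≥0 using hc
  lift l to ℝ≥0 using hl
  have h' : (m : ℝ) ^ (1 / p) ≤ (c : ℝ) ^ (1 / p) + l := by
    rw [← ENNReal.coe_rpow_of_nonneg _ (by positivity),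
      ← ENNReal.coe_rpow_of_nonneg _ (by positivity)] at h
    exact_mod_cast h
  have key := rpow_le_rpow_add_mul_of_le_add hp (by positivity) (by positivity) l.2 h'
  rw [← Real.rpow_mul m.coe_nonneg, ← Real.rpow_mul c.coe_nonneg, ← Real.rpow_mul m.coe_nonneg,
    one_div_mul_cancel hp0.ne', Real.rpow_one, Real.rpow_one,
    show 1 / p * (p - 1) = 1 - 1 / p by field_simp] at key
  rw [ENNReal.coe_toReal] at hcoef ⊢
  have hcast : ENNReal.ofReal (m : ℝ) ≤ ENNReal.ofReal (c + p * (m : ℝ) ^ (1 - 1 / p) * l) :=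
    ENNReal.ofReal_le_ofReal key
  rw [ENNReal.ofReal_add c.coe_nonneg (by positivity), ENNReal.ofReal_mul hcoef.le] at hcast
  simpa only [ENNReal.ofReal_coe_nnreal] using hcast

/-- Concentrating `ν` at a point of its support costs at most a multiple of its length. -/
lemma le_wassersteinPow_add_lengthFunctional (hp : 1 ≤ p)
    {μ ν : Measure (EuclideanSpace ℝ (Fin d))} [IsProbabilityMeasure μ] [IsProbabilityMeasure ν]
    (hν : lengthFunctional ν ≠ ∞) {m : ℝ≥0∞} (hm : m ≠ ∞)
    (hle : ∀ y, m ≤ ∫⁻ x, ‖x - y‖ₑ ^ p ∂μ) :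
    m ≤ wassersteinPow p μ ν
      + ENNReal.ofReal (p * m.toReal ^ (1 - 1 / p)) * lengthFunctional ν := by
  have hp0 : 0 < p := by linarith
  obtain ⟨y, hy⟩ := (isConnected_support_of_lengthFunctional_ne_top hν).nonempty
  rw [← tsub_le_iff_right]
  refine le_iInf₂ fun γ hγ => ?_
  rw [tsub_le_iff_right]
  -- It remains to compare `L^p` norms, where Minkowski's inequality applies.
  apply ennreal_le_add_mul_of_rpow_inv_le_add hp hm
  have hγp : γ Set.univ = 1 := by
    have : (γ.map Prod.fst) Set.univ = 1 := by rw [hγ.1]; exact measure_univ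
    rwa [Measure.map_apply measurable_fst MeasurableSet.univ, Set.preimage_univ] at this
  let f : EuclideanSpace ℝ (Fin d) × EuclideanSpace ℝ (Fin d) → ℝ≥0∞ := fun z => ‖z.1 - z.2‖ₑ
  have hf : Measurable f := by fun_prop
  let g : EuclideanSpace ℝ (Fin d) × EuclideanSpace ℝ (Fin d) → ℝ≥0∞ := fun _ => lengthFunctional ν
  calc m ^ (1 / p) ≤ (∫⁻ z, ‖z.1 - y‖ₑ ^ p ∂γ) ^ (1 / p) := by
        refine ENNReal.rpow_le_rpow ((hle y).trans_eq ?_) (by positivity)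
        exact (lintegral_fst_of_mem_couplings hγ (f := fun x => ‖x - y‖ₑ ^ p)
          (by fun_prop)).symm
    _ ≤ (∫⁻ z, (f + g) z ^ p ∂γ) ^ (1 / p) := by
        refine ENNReal.rpow_le_rpow (lintegral_mono_ae ?_) (by positivity)
        filter_upwards [ae_snd_of_mem_couplings hγ (Measure.support_mem_ae (μ := ν))] with z hz
        refine ENNReal.rpow_le_rpow ?_ hp0.le
        calc ‖z.1 - y‖ₑ ≤ ‖z.1 - z.2‖ₑ + ‖z.2 - y‖ₑ := by
              rw [← sub_add_sub_cancel z.1 z.2 y]; exact enorm_add_le _ _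
          _ ≤ _ := by
              rw [← edist_eq_enorm_sub z.2 y]
              exact add_le_add_right (edist_le_lengthFunctional hν hz hy) _
    _ ≤ (∫⁻ z, ‖z.1 - z.2‖ₑ ^ p ∂γ) ^ (1 / p)
          + (∫⁻ _, lengthFunctional ν ^ p ∂γ) ^ (1 / p) :=
        ENNReal.lintegral_Lp_add_le hf.aemeasurable aemeasurable_const hp
    _ = _ := by
        rw [lintegral_const, hγp, mul_one, ← ENNReal.rpow_mul, mul_one_div_cancel hp0.ne',
          ENNReal.rpow_one]

/-! ### Existence of `p`-means -/

/-- Constants embed isometrically in `L^p(μ)`, so the distance from the identity map to the constant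
`y` is continuous and coercive in `y`. -/
lemma exists_mem_pMeans (hp : 1 ≤ p) {μ : Measure (EuclideanSpace ℝ (Fin d))}
    (hμ : μ ∈ ProbP d p) : ∃ y, y ∈ pMeans p μ := by
  have hp0 : 0 < p := by linarith
  have := hμ.1
  set q : ℝ≥0∞ := ENNReal.ofReal p with hq
  have hq0 : q ≠ 0 := by simpa [hq] using hp0
  have hqt : q ≠ ∞ := ENNReal.ofReal_ne_top
  have hqr : q.toReal = p := ENNReal.toReal_ofReal hp0.le
  have : Fact (1 ≤ q) := ⟨by rw [hq]; simpa using hp⟩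
  have hid : MemLp (fun x : EuclideanSpace ℝ (Fin d) => x) q μ := by
    refine ⟨aestronglyMeasurable_id, ?_⟩
    rw [eLpNorm_eq_lintegral_rpow_enorm_toReal hq0 hqt, hqr]
    exact ENNReal.rpow_lt_top_of_nonneg (by positivity) hμ.2.ne
  let F : Lp (EuclideanSpace ℝ (Fin d)) q μ := hid.toLp
  let c : EuclideanSpace ℝ (Fin d) →L[ℝ] Lp (EuclideanSpace ℝ (Fin d)) q μ := Lp.constL q μ ℝ
  have hc : ∀ y, ‖c y‖ = ‖y‖ := fun y => by
    have h := Lp.norm_const' (μ := μ) (c := y) (hp_zero := hq0) (hp_top := hqt)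
    rw [probReal_univ, Real.one_rpow, mul_one] at h
    exact h
  have hnorm : ∀ y, ENNReal.ofReal ‖F - c y‖ ^ p = ∫⁻ x, ‖x - y‖ₑ ^ p ∂μ := fun y => by
    have h1 : F - c y = (hid.sub (memLp_const y)).toLp := rfl
    rw [h1, ofReal_norm, Lp.enorm_toLp, eLpNorm_eq_lintegral_rpow_enorm_toReal hq0 hqt, hqr,
      ← ENNReal.rpow_mul, one_div_mul_cancel hp0.ne', ENNReal.rpow_one]
    rfl
  have hcont : Continuous fun y => ‖F - c y‖ := by fun_prop
  have hlim : Tendsto (fun y => ‖F - c y‖) (cocompact _) atTop := by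
    refine tendsto_atTop_mono (fun y => ?_)
      (tendsto_atTop_add_const_right _ (-‖F‖) tendsto_norm_cocompact_atTop)
    have := norm_sub_norm_le (c y) F
    rw [hc, norm_sub_rev] at this
    linarith
  obtain ⟨y, hy⟩ := hcont.exists_forall_le hlim
  refine ⟨y, fun z => ?_⟩
  rw [← hnorm, ← hnorm]
  exact ENNReal.rpow_le_rpow (ENNReal.ofReal_le_ofReal (hy z)) hp0.le

/-! ### Competitors carried by a segment -/

lemma mem_ProbP_of_ae_mem_isBounded (hp : 1 ≤ p) {ν : Measure (EuclideanSpace ℝ (Fin d))}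
    [IsProbabilityMeasure ν] {K : Set (EuclideanSpace ℝ (Fin d))} (hK : Bornology.IsBounded K)
    (h : ∀ᵐ x ∂ν, x ∈ K) : ν ∈ ProbP d p := by
  refine ⟨inferInstance, ?_⟩
  obtain ⟨R, hR⟩ := hK.exists_norm_le
  calc ∫⁻ x, ‖x‖ₑ ^ p ∂ν ≤ ∫⁻ _, ENNReal.ofReal R ^ p ∂ν := by
        refine lintegral_mono_ae ?_
        filter_upwards [h] with x hx
        refine ENNReal.rpow_le_rpow ?_ (by linarith)
        rw [← ofReal_norm]
        exact ENNReal.ofReal_le_ofReal (hR x hx)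
    _ < ∞ := by
        rw [lintegral_const, measure_univ, mul_one]
        exact ENNReal.rpow_lt_top_of_nonneg (by linarith) ENNReal.ofReal_ne_top

/-- Each point is a limit of other points of the segment, and the subsegment to a nearby one has
positive length. -/
lemma segment_subset_support_restrict_hausdorffMeasure {x y : EuclideanSpace ℝ (Fin d)}
    (hxy : x ≠ y) : segment ℝ x y ⊆ ((μH[1]).restrict (segment ℝ x y)).support := by
  intro z hz
  have hconv := convex_segment (𝕜 := ℝ) x y
  have hacc : AccPt z (𝓟 (segment ℝ x y)) :=
    hconv.isPreconnected.preperfect_of_nontrivial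
      ⟨x, left_mem_segment ℝ x y, y, right_mem_segment ℝ x y, hxy⟩ z hz
  rw [Measure.mem_support_iff_forall]
  intro U hU
  obtain ⟨δ, hδ, hball⟩ := Metric.mem_nhds_iff.1 hU
  obtain ⟨w, ⟨hwb, hws⟩, hwz⟩ := accPt_iff_nhds.1 hacc _ (Metric.ball_mem_nhds z hδ)
  have hsub : segment ℝ z w ⊆ U ∩ segment ℝ x y :=
    Set.subset_inter
      (((convex_ball z δ).segment_subset (Metric.mem_ball_self hδ) hwb).trans hball)
      (hconv.segment_subset hz hws)
  calc 0 < edist z w := edist_pos.2 hwz.symm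
    _ = μH[1] (segment ℝ z w) := (hausdorffMeasure_segment z w).symm
    _ ≤ μH[1] (U ∩ segment ℝ x y) := measure_mono hsub
    _ ≤ (μH[1]).restrict (segment ℝ x y) U := Measure.le_restrict_apply _ _

/-- A measure carried by a segment that dominates a multiple of its length has finite length. -/
lemma lengthFunctional_lt_top_of_segment {ν : Measure (EuclideanSpace ℝ (Fin d))}
    {x y : EuclideanSpace ℝ (Fin d)} (hxy : x ≠ y) (h : ∀ᵐ z ∂ν, z ∈ segment ℝ x y) {c : ℝ≥0}
    (hc : c ≠ 0) (hle : c • (μH[1]).restrict (segment ℝ x y) ≤ ν) :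
    lengthFunctional ν < ∞ := by
  have hclosed : IsClosed (segment ℝ x y) := by
    rw [← convexHull_pair]; exact (Set.toFinite _).isClosed_convexHull ℝ
  have hle' : (μH[1]).restrict (segment ℝ x y) ≤ c⁻¹ • ν := by
    calc (μH[1]).restrict (segment ℝ x y)
        = c⁻¹ • c • (μH[1]).restrict (segment ℝ x y) := by
          rw [smul_smul, inv_mul_cancel₀ hc, one_smul]
      _ ≤ c⁻¹ • ν := by gcongr
  have hac : (μH[1]).restrict (segment ℝ x y) ≪ ν :=
    (Measure.absolutelyContinuous_of_le hle').trans Measure.smul_absolutelyContinuous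
  have hsupp : ν.support = segment ℝ x y :=
    (Measure.support_subset_of_isClosed hclosed h).antisymm
      ((segment_subset_support_restrict_hausdorffMeasure hxy).trans hac.support_mono)
  unfold lengthFunctional
  rw [if_pos (by
    rw [hsupp]
    exact (convex_segment x y).isConnected ⟨x, left_mem_segment ℝ x y⟩), hsupp]
  exact (iInf₂_le c⁻¹ hle').trans_lt ENNReal.coe_lt_top

lemma smul_add_smul_mem_couplings {μ ν₁ ν₂ : Measure (EuclideanSpace ℝ (Fin d))}
    {γ₁ γ₂ : Measure (EuclideanSpace ℝ (Fin d) × EuclideanSpace ℝ (Fin d))}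
    (h₁ : γ₁ ∈ couplings μ ν₁) (h₂ : γ₂ ∈ couplings μ ν₂) {a b : ℝ≥0} (hab : a + b = 1) :
    a • γ₁ + b • γ₂ ∈ couplings μ (a • ν₁ + b • ν₂) := by
  constructor
  · rw [Measure.map_add _ _ measurable_fst, Measure.map_smul, Measure.map_smul, h₁.1, h₂.1,
      ← add_smul, hab, one_smul]
  · rw [Measure.map_add _ _ measurable_snd, Measure.map_smul, Measure.map_smul, h₁.2, h₂.2]

/-- If `μ` is not a Dirac mass, every Dirac mass is beaten in transport cost by a measure of
finite length. -/
lemma exists_wassersteinPow_lt (hp : 1 ≤ p) {μ : Measure (EuclideanSpace ℝ (Fin d))}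
    (hμ : μ ∈ ProbP d p) (hd : ¬ IsDirac μ) (y : EuclideanSpace ℝ (Fin d)) :
    ∃ ν ∈ ProbP d p, lengthFunctional ν < ∞ ∧
      wassersteinPow p μ ν < ∫⁻ x, ‖x - y‖ₑ ^ p ∂μ := by
  classical
  have hp0 : 0 < p := by linarith
  have := hμ.1
  obtain ⟨x₀, hx₀, hne⟩ : ∃ x₀ ∈ μ.support, x₀ ≠ y := by
    by_contra! hcon
    exact hd ⟨y, eq_dirac_of_support_subset hcon⟩
  -- Points closer to `x₀` than to `y`: sending them to `x₀` is a strict gain, since `B` is a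
  -- neighbourhood of a support point.
  let B : Set (EuclideanSpace ℝ (Fin d)) := {x | ‖x - x₀‖ₑ < ‖x - y‖ₑ}
  have hBo : IsOpen B := isOpen_lt (by fun_prop) (by fun_prop)
  have hB : μ B ≠ 0 := ((Measure.mem_support_iff_forall x₀).1 hx₀ B
    (hBo.mem_nhds (by simpa [B, sub_eq_zero, pos_iff_ne_zero] using hne))).ne'
  let T : EuclideanSpace ℝ (Fin d) → EuclideanSpace ℝ (Fin d) :=
    fun x => if x ∈ B then x₀ else y
  have hT : Measurable T := Measurable.ite hBo.measurableSet measurable_const measurable_const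
  have hTle : ∀ x, ‖x - T x‖ₑ ^ p ≤ ‖x - y‖ₑ ^ p := fun x => by
    refine ENNReal.rpow_le_rpow ?_ hp0.le
    by_cases hx : x ∈ B
    · simp only [T, if_pos hx]; exact le_of_lt hx
    · simp only [T, if_neg hx]; exact le_rfl
  have hMfin := lintegral_sub_rpow_lt_top hp hμ y
  have hTfin : ∫⁻ x, ‖x - T x‖ₑ ^ p ∂μ ≠ ∞ := ((lintegral_mono hTle).trans_lt hMfin).ne
  have hTlt : ∫⁻ x, ‖x - T x‖ₑ ^ p ∂μ < ∫⁻ x, ‖x - y‖ₑ ^ p ∂μ := by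
    refine lintegral_strict_mono_of_ae_le_of_ae_lt_on (by fun_prop) hTfin
      (ae_of_all _ hTle) hB (ae_of_all _ fun x hx => ENNReal.rpow_lt_rpow ?_ hp0)
    simp only [T, if_pos hx]; exact hx
  let l : ℝ≥0 := nndist y x₀
  have hl : l ≠ 0 := by simpa [l] using hne.symm
  let U : Measure (EuclideanSpace ℝ (Fin d)) := l⁻¹ • (μH[1]).restrict (segment ℝ y x₀)
  have hUprob : IsProbabilityMeasure U := ⟨by
    simp only [U, Measure.smul_apply, Measure.restrict_apply_univ, hausdorffMeasure_segment]
    rw [edist_nndist, ENNReal.smul_def, smul_eq_mul, ← ENNReal.coe_mul, inv_mul_cancel₀ hl,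
      ENNReal.coe_one]⟩
  have hclosed : IsClosed (segment ℝ y x₀) := by
    rw [← convexHull_pair]; exact (Set.toFinite _).isClosed_convexHull ℝ
  have hbdd : Bornology.IsBounded (segment ℝ y x₀) := by
    rw [← convexHull_pair]
    exact isBounded_convexHull.2 (Set.toFinite _).isBounded
  have hUae : ∀ᵐ z ∂U, z ∈ segment ℝ y x₀ :=
    Measure.ae_smul_measure (ae_restrict_mem hclosed.measurableSet) _
  have hTae : ∀ᵐ z ∂(μ.map T), z ∈ segment ℝ y x₀ := by
    refine (ae_map_iff (p := (· ∈ segment ℝ y x₀)) hT.aemeasurable hclosed.measurableSet).2 ?_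
    refine ae_of_all _ fun x => ?_
    by_cases hx : x ∈ B
    · simp only [T, if_pos hx]; exact right_mem_segment ℝ y x₀
    · simp only [T, if_neg hx]; exact left_mem_segment ℝ y x₀
  have hγU : μ.prod U ∈ couplings μ U := by
    constructor <;> simp
  have hUfin := lintegral_cost_lt_top hp hμ (mem_ProbP_of_ae_mem_isBounded hp hbdd hUae) hγU
  -- The weight of the uniform measure `U` is chosen so that its cost stays below the gain of `T`.
  obtain ⟨ε', hε', hεlt'⟩ := ENNReal.exists_nnreal_pos_mul_lt hUfin.ne
    (tsub_pos_of_lt hTlt).ne'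
  let ε : ℝ≥0 := min ε' 1
  have hε : 0 < ε := lt_min hε' one_pos
  have hε1 : 1 - ε + ε = 1 := tsub_add_cancel_of_le (min_le_right _ _)
  have hεlt : (ε : ℝ≥0∞) * ∫⁻ z, ‖z.1 - z.2‖ₑ ^ p ∂(μ.prod U)
      < ∫⁻ x, ‖x - y‖ₑ ^ p ∂μ - ∫⁻ x, ‖x - T x‖ₑ ^ p ∂μ := by
    refine lt_of_le_of_lt ?_ hεlt'
    gcongr
    exact min_le_left _ _
  have hγ := smul_add_smul_mem_couplings (map_prodMk_mem_couplings (μ := μ) hT) hγU hε1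
  have hTprob : IsProbabilityMeasure (μ.map T) := Measure.isProbabilityMeasure_map hT.aemeasurable
  have hae : ∀ᵐ z ∂((1 - ε) • μ.map T + ε • U), z ∈ segment ℝ y x₀ := by
    rw [ae_add_measure_iff]
    exact ⟨Measure.ae_smul_measure hTae _, Measure.ae_smul_measure hUae _⟩
  have hprob : IsProbabilityMeasure ((1 - ε) • μ.map T + ε • U) := ⟨by
    simp only [Measure.add_apply, Measure.smul_apply, measure_univ]
    rw [← add_smul, hε1, one_smul]⟩
  refine ⟨_, mem_ProbP_of_ae_mem_isBounded hp hbdd hae, ?_, (iInf₂_le _ hγ).trans_lt ?_⟩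
  · refine lengthFunctional_lt_top_of_segment hne.symm hae (c := ε * l⁻¹)
      (mul_ne_zero hε.ne' (inv_ne_zero hl)) ?_
    rw [mul_smul]
    exact Measure.le_add_left le_rfl
  · rw [lintegral_add_measure, lintegral_smul_measure, lintegral_smul_measure,
      lintegral_cost_map_prodMk hT]
    calc (1 - ε) • ∫⁻ x, ‖x - T x‖ₑ ^ p ∂μ + ε • ∫⁻ z, ‖z.1 - z.2‖ₑ ^ p ∂(μ.prod U)
        ≤ ∫⁻ x, ‖x - T x‖ₑ ^ p ∂μ + ε * ∫⁻ z, ‖z.1 - z.2‖ₑ ^ p ∂(μ.prod U) := by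
          refine add_le_add ?_ le_rfl
          rw [ENNReal.smul_def, smul_eq_mul]
          exact mul_le_of_le_one_left zero_le (by exact_mod_cast tsub_le_self)
      _ < ∫⁻ x, ‖x - T x‖ₑ ^ p ∂μ
          + (∫⁻ x, ‖x - y‖ₑ ^ p ∂μ - ∫⁻ x, ‖x - T x‖ₑ ^ p ∂μ) :=
          ENNReal.add_lt_add_left hTfin hεlt
      _ = ∫⁻ x, ‖x - y‖ₑ ^ p ∂μ := add_tsub_cancel_of_le hTlt.le

/-! ### The threshold -/

lemma energy_mono (μ ν : Measure (EuclideanSpace ℝ (Fin d))) {Λ Λ' : ℝ≥0} (h : Λ ≤ Λ') :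
    energy p μ Λ ν ≤ energy p μ Λ' ν := by
  unfold energy
  gcongr

/-- The parameters at which no competitor beats concentrating at `y`. -/
def diracOptimal (p : ℝ) (μ : Measure (EuclideanSpace ℝ (Fin d)))
    (y : EuclideanSpace ℝ (Fin d)) : Set ℝ≥0 :=
  {Λ | ∀ ν ∈ ProbP d p, ∫⁻ x, ‖x - y‖ₑ ^ p ∂μ ≤ energy p μ Λ ν}

lemma diracOptimal_nonempty (hp : 1 ≤ p) {μ : Measure (EuclideanSpace ℝ (Fin d))}
    (hμ : μ ∈ ProbP d p) {y : EuclideanSpace ℝ (Fin d)} (hy : y ∈ pMeans p μ) :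
    (diracOptimal p μ y).Nonempty := by
  have := hμ.1
  -- Adding `1` keeps the parameter positive, so infinite length gives infinite energy.
  refine ⟨Real.toNNReal (p * (∫⁻ x, ‖x - y‖ₑ ^ p ∂μ).toReal ^ (1 - 1 / p)) + 1,
    fun ν hν => ?_⟩
  have := hν.1
  rcases eq_or_ne (lengthFunctional ν) ∞ with h | h
  · rw [energy, h, ENNReal.mul_top (by simp)]; simp
  · refine (le_wassersteinPow_add_lengthFunctional hp h
      (lintegral_sub_rpow_lt_top hp hμ y).ne hy).trans ?_
    exact energy_mono μ ν (self_le_add_right _ 1)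

/-- Above a parameter at which concentrating at a `p`-mean is optimal, all minimizers are Dirac
masses at `p`-means. -/
lemma minimizers_eq_of_lt (hp : 1 ≤ p) {μ : Measure (EuclideanSpace ℝ (Fin d))}
    (hμ : μ ∈ ProbP d p) {y : EuclideanSpace ℝ (Fin d)} (hy : y ∈ pMeans p μ) {Λ' Λ : ℝ≥0}
    (hΛ' : Λ' ∈ diracOptimal p μ y) (h : Λ' < Λ) :
    minimizers p μ Λ = {ν | ∃ y ∈ pMeans p μ, ν = Measure.dirac y} := by
  have := hμ.1
  ext ν
  constructor
  · rintro ⟨hν, hmin⟩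
    have := hν.1
    have hfin := lintegral_sub_rpow_lt_top hp hμ y
    have h1 : energy p μ Λ ν ≤ ∫⁻ x, ‖x - y‖ₑ ^ p ∂μ :=
      (hmin _ (dirac_mem_ProbP hp y)).trans_eq (energy_dirac μ Λ y)
    have h2 := hΛ' ν hν
    have h3 : energy p μ Λ ν
        = energy p μ Λ' ν + ((Λ - Λ' : ℝ≥0) : ℝ≥0∞) * lengthFunctional ν := by
      rw [energy, energy, add_assoc, ← add_mul, ← ENNReal.coe_add,
        add_tsub_cancel_of_le h.le]
    have h4 : energy p μ Λ' ν ≠ ∞ :=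
      (((energy_mono μ ν h.le).trans h1).trans_lt hfin).ne
    have h5 : ((Λ - Λ' : ℝ≥0) : ℝ≥0∞) * lengthFunctional ν = 0 := by
      rw [h3] at h1
      have h6 : energy p μ Λ' ν + ((Λ - Λ' : ℝ≥0) : ℝ≥0∞) * lengthFunctional ν
          ≤ energy p μ Λ' ν + 0 := by rw [add_zero]; exact h1.trans h2
      exact le_antisymm ((ENNReal.add_le_add_iff_left h4).1 h6) zero_le
    have h7 : lengthFunctional ν = 0 := by
      refine (mul_eq_zero.1 h5).resolve_left ?_
      exact_mod_cast (tsub_pos_of_lt h).ne'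
    obtain ⟨z, rfl⟩ := isDirac_of_lengthFunctional_eq_zero h7
    rw [energy_dirac] at h1
    exact ⟨z, fun w => h1.trans (hy w), rfl⟩
  · rintro ⟨z, hz, rfl⟩
    refine ⟨dirac_mem_ProbP hp z, fun ν hν => ?_⟩
    rw [energy_dirac]
    exact (hz y).trans ((hΛ' ν hν).trans (energy_mono μ ν h.le))

/-- The strict transport gain of a finite-length competitor absorbs its length penalty for small
parameters. -/
lemma exists_pos_forall_notMem_diracOptimal (hp : 1 ≤ p)
    {μ : Measure (EuclideanSpace ℝ (Fin d))} (hμ : μ ∈ ProbP d p) (hd : ¬ IsDirac μ)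
    (y : EuclideanSpace ℝ (Fin d)) : ∃ Λ > 0, ∀ Λ' ≤ Λ, Λ' ∉ diracOptimal p μ y := by
  obtain ⟨ν, hν, hL, hW⟩ := exists_wassersteinPow_lt hp hμ hd y
  obtain ⟨Λ, hΛ, hlt⟩ := ENNReal.exists_nnreal_pos_mul_lt hL.ne (tsub_pos_of_lt hW).ne'
  refine ⟨Λ, hΛ, fun Λ' hle hmem => ?_⟩
  refine ((hmem ν hν).trans (energy_mono μ ν hle)).not_gt ?_
  calc energy p μ Λ ν
      < wassersteinPow p μ ν + (∫⁻ x, ‖x - y‖ₑ ^ p ∂μ - wassersteinPow p μ ν) :=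
        ENNReal.add_lt_add_left hW.ne_top hlt
    _ = ∫⁻ x, ‖x - y‖ₑ ^ p ∂μ := add_tsub_cancel_of_le hW.le

end WassersteinLength

open WassersteinLength in
theorem theorem4p1 (d : ℕ) (p : ℝ) (hp : 1 ≤ p)
    (ρ₀ : Measure (EuclideanSpace ℝ (Fin d))) (hρ₀ : ρ₀ ∈ WassersteinLength.ProbP d p) :
    ∃ Λstar : ℝ≥0,
      (∀ Λ : ℝ≥0, Λ < Λstar →
        ∀ ν ∈ WassersteinLength.minimizers p ρ₀ Λ, ¬ WassersteinLength.IsDirac ν) ∧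
      (∀ Λ : ℝ≥0, Λstar < Λ →
        WassersteinLength.minimizers p ρ₀ Λ =
          {ν | ∃ y ∈ WassersteinLength.pMeans p ρ₀, ν = Measure.dirac y}) ∧
      (Λstar = 0 ↔ WassersteinLength.IsDirac ρ₀) := by
  have := hρ₀.1
  obtain ⟨y, hy⟩ := exists_mem_pMeans hp hρ₀
  have hne := diracOptimal_nonempty hp hρ₀ hy
  refine ⟨sInf (diracOptimal p ρ₀ y), ?_, ?_, ?_⟩
  · rintro Λ hΛ _ ⟨-, hmin⟩ ⟨z, rfl⟩
    refine notMem_of_lt_csInf hΛ (OrderBot.bddBelow _) fun ν hν => ?_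
    refine (hy z).trans ?_
    rw [← energy_dirac ρ₀ Λ z]
    exact hmin ν hν
  · intro Λ hΛ
    obtain ⟨Λ', hΛ', hlt⟩ := exists_lt_of_csInf_lt hne hΛ
    exact minimizers_eq_of_lt hp hρ₀ hy hΛ' hlt
  · constructor
    · intro h0
      by_contra hd
      obtain ⟨Λ, hΛ, hnot⟩ := exists_pos_forall_notMem_diracOptimal hp hρ₀ hd y
      obtain ⟨Λ', hΛ', hlt⟩ := exists_lt_of_csInf_lt hne (h0.trans_lt hΛ)
      exact hnot Λ' hlt.le hΛ'
    -- The `p`-mean has zero cost here, so `0` already lies in `diracOptimal`.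
    · rintro ⟨x, rfl⟩
      refine le_antisymm (csInf_le (OrderBot.bddBelow _) fun ν _ => ?_) zero_le
      refine (hy x).trans ?_
      rw [lintegral_dirac, sub_self, enorm_zero, ENNReal.zero_rpow_of_pos (by linarith)]
      exact zero_le
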